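/- Let $a\in\mathbb R$, let $\underline\beta,\overline\beta,\underline\eta,\overline\eta,\overline\nu>0$, and let $h:\mathbb R\to\mathbb R$ be measurable and bounded. Consider the optimization problem $$\max_f\ \int_a^\infty h(x)f(x)\,dx\qquad(\ast)$$ over all functions $f:[a,\infty)\to\mathbb R$ that are convex and non-negative on $[a,\infty)$ and satisfy $\underline\beta\le\int_a^\infty f(x)\,dx\le\overline\beta$, $\ \underline\eta\le f(a)=f(a+)\le\overline\eta$ and $f_+'(a)\ge-\overline\nu$, where $f(a+)$ is the right limit and $f'_+(a)$ the right derivative of $f$ at $a$. Let $Z^*$ be the optimal value (the supremum) of $(\ast)$. Let $\mathcal{PL}_3^+[a,\infty)$ be the set of non-negative continuous functions $f$ on $[a,\infty)$ for which there are $a=y_0\le y_1\le y_2\le y_3<\infty$ and $c_j,d_j\in\mathbb R$ with $f(x)=c_j+d_jx$ for $x\in[y_{j-1},y_j]$, $j=1,2,3$, and $f(x)=0$ for $x>y_3$. If $(\ast)$ is feasible, then one of the following holds: 1. An optimal solution $f^*$ of $(\ast)$ exists with $f^*\in\mathcal{PL}_3^+[a,\infty)$. 2. An optimal solution of $(\ast)$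 does not exist, and $Z^*$ is finite. There is a sequence $f^{(k)}\in\mathcal{PL}_3^+[a,\infty)$, $k\ge1$, each $f^{(k)}$ feasible for $(\ast)$, with $\int_a^\infty h(x)f^{(k)}(x)\,dx\to Z^*$ as $k\to\infty$. Moreover, the segments of the $f^{(k)}$ can be chosen so that the last segment $\{c_3^{(k)}+d_3^{(k)}x:x\in[y_2^{(k)},y_3^{(k)}]\}$ has $y_2^{(k)}<y_3^{(k)}$ and $d_3^{(k)}<0$ for every $k$, and, as $k\to\infty$, $y_3^{(k)}$ is strictly increasing with $y_3^{(k)}\to\infty$, and $|d_3^{(k)}|$ is strictly decreasing with $d_3^{(k)}\to0$. -/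

import Mathlib

open Set Filter Topology MeasureTheory

/-- Feasibility of `f` (viewed on `[a, ∞)`) for the tail extrapolation problem with tail mass in
`[βl, βu]`, density value at `a` in `[ηl, ηu]`, and right derivative at `a` at least `-νu`.
Only the values of `f` on `[a, ∞)` matter. -/
structure IsFeasible (a βl βu ηl ηu νu : ℝ) (f : ℝ → ℝ) : Prop where
  integrable : IntegrableOn f (Ici a)
  mass_ge : βl ≤ ∫ x in Ici a, f x
  mass_le : ∫ x in Ici a, f x ≤ βu
  right_continuous : Tendsto f (𝓝[>] a) (𝓝 (f a))
  value_ge : ηl ≤ f a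
  value_le : f a ≤ ηu
  /-- The right derivative at `a` exists (as a real number) and is at least `-νu`. -/
  slope_ge : ∃ s : ℝ, HasDerivWithinAt f s (Ioi a) a ∧ -νu ≤ s
  convex : ConvexOn ℝ (Ici a) f
  nonneg : ∀ x ∈ Ici a, 0 ≤ f x

/-- The objective `∫_a^∞ h(x) f(x) dx`. -/
noncomputable def objective (a : ℝ) (h f : ℝ → ℝ) : ℝ :=
  ∫ x in Ici a, h x * f x

/-- `f` is an optimal solution of the maximization problem. -/
def IsOptimal (a βl βu ηl ηu νu : ℝ) (h f : ℝ → ℝ) : Prop :=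
  IsFeasible a βl βu ηl ηu νu f ∧
    ∀ g : ℝ → ℝ, IsFeasible a βl βu ηl ηu νu g → objective a h g ≤ objective a h f

/-- `Z` is the optimal value (least upper bound of the objective over all feasible functions). -/
def IsOptimalValue (a βl βu ηl ηu νu : ℝ) (h : ℝ → ℝ) (Z : ℝ) : Prop :=
  IsLUB (objective a h '' {f | IsFeasible a βl βu ηl ηu νu f}) Z

/-- `f` is given on `[a, ∞)` by the `m` line segments `c j + d j * x` on `[y j, y (j+1)]`,
`a = y 0 ≤ y 1 ≤ ⋯ ≤ y m`, and vanishes after `y m`. The segments are indexed from `0`, so that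
the last one has index `m - 1`. -/
structure HasSegments (a : ℝ) (m : ℕ) (f : ℝ → ℝ) (y : Fin (m + 1) → ℝ) (c d : Fin m → ℝ) :
    Prop where
  start : y 0 = a
  mono : Monotone y
  linear : ∀ j : Fin m, ∀ x ∈ Icc (y j.castSucc) (y j.succ), f x = c j + d j * x
  vanish : ∀ x, y (Fin.last m) < x → f x = 0

/-- Non-negative continuous functions on `[a, ∞)` with at most `m` line segments before
vanishing. -/
def PLPlus (m : ℕ) (a : ℝ) : Set (ℝ → ℝ) :=
  {f | ContinuousOn f (Ici a) ∧ (∀ x ∈ Ici a, 0 ≤ f x) ∧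
    ∃ (y : Fin (m + 1) → ℝ) (c d : Fin m → ℝ), HasSegments a m f y c d}

/-! A feasible `f` is integrable, convex and non-negative, hence decreases to `0`, and `p = -f'₊` is
antitone with values in `[0, νu]`. Since `f x = ∫_x^∞ p`, slicing `p` by level (layer cake) gives `f
x = ∫_0^νu (T s - x)⁺ ds`, where `T s` is the point at which `p` drops to level `s`. So `f` is a
mixture, of total weight `νu`, of tents `(t - x)⁺` with `t ≥ a`; `f a`, the mass and the objective
are integrals of `t - a`, `(t - a)² / 2` and `tentObjective a h t` against the mixing measure.

The mean of a random vector lies in the convex hull of its range even when the hull is not closed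
(`Convex.integral_mem_of_finiteDimensional`), so finitely many tents reproduce these numbers
exactly. The constraints involve only the moments of order 0, 1, 2, so moving along affine
dependencies leaves at most three tents without lowering the objective
(`exists_card_le_three_weights`). Three tents form a function in `PLPlus 3 a`, so an optimum, if
there is one, is attained there.

Otherwise, three-tent functions supported in `[a, R]` have compact parameter space and their best
value is attained, hence strictly below `Z`. Near-optimal ones must therefore reach beyond any `R`
(`exists_far_tents`). The bound `w₂ (t₂ - a) ≤ ηu` then forces the last slope to `0`, and
subsequences make both monotonicities strict. -/

/-! ### Expectations in convex sets that need not be closed -/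

section ConvexIntegral

variable {E : Type*} [NormedAddCommGroup E] [NormedSpace ℝ E] [FiniteDimensional ℝ E]

/-- In finite dimension, a convex set that misses the origin lies in a closed half-space. -/
theorem Convex.exists_ne_zero_forall_nonpos {s : Set E} (hs : Convex ℝ s) (hne : s.Nonempty)
    (h0 : (0 : E) ∉ s) : ∃ l : E →L[ℝ] ℝ, l ≠ 0 ∧ ∀ x ∈ s, l x ≤ 0 := by
  by_cases hspan : Submodule.span ℝ s = ⊤
  -- If `0` is a limit of `s`, the affine span, being closed, contains `0` and so is the whole
  -- space. Then `s` has interior points and `0` can be separated from it.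
  · by_cases hcl : (0 : E) ∈ closure s
    · have hsub : s ⊆ (affineSpan ℝ s : Set E) := subset_affineSpan ℝ s
      have h0' : (0 : E) ∈ affineSpan ℝ s :=
        closure_minimal hsub (affineSpan ℝ s).closed_of_finiteDimensional hcl
      have htop : affineSpan ℝ s = ⊤ := by
        rw [← affineSpan_insert_eq_affineSpan ℝ h0', ← SetLike.coe_set_eq, affineSpan_insert_zero,
          hspan]
        rfl
      obtain ⟨f, hf, hf'⟩ := geometric_hahn_banach_of_nonempty_interior_point hs
        (fun h => h0 (interior_subset h)) (hs.interior_nonempty_iff_affineSpan_eq_top.2 htop)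
      exact ⟨f, hf, fun x hx => by simpa using hf' x hx⟩
    · obtain ⟨f, u, hf, hu⟩ := geometric_hahn_banach_closed_point hs.closure isClosed_closure hcl
      obtain ⟨x, hx⟩ := hne
      rw [map_zero] at hu
      refine ⟨f, ?_, fun y hy => ((hf y (subset_closure hy)).trans hu).le⟩
      rintro rfl
      simpa using (hf x (subset_closure hx)).trans hu
  · obtain ⟨f, hf, hf'⟩ := Submodule.exists_le_ker_of_lt_top _ (lt_top_iff_ne_top.2 hspan)
    refine ⟨LinearMap.toContinuousLinearMap f, by simpa using hf, fun x hx => ?_⟩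
    exact le_of_eq (hf' (Submodule.subset_span hx))

/-- Induction on the dimension. If `0 ∉ s`, some `l ≠ 0` is non-positive on `s`; as `l ∘ f` has mean
zero it vanishes almost everywhere, so `f` lives in the hyperplane `ker l`, where the induction
hypothesis applies. -/
theorem Convex.zero_mem_of_integral_eq_zero {Ω : Type*} [MeasurableSpace Ω] {μ : Measure Ω}
    [IsProbabilityMeasure μ] (n : ℕ) : ∀ (E : Type*) [NormedAddCommGroup E] [NormedSpace ℝ E]
    [FiniteDimensional ℝ E], Module.finrank ℝ E = n → ∀ (s : Set E), Convex ℝ s → ∀ f : Ω → E,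
    (∀ᵐ x ∂μ, f x ∈ s) → Integrable f μ → ∫ x, f x ∂μ = 0 → (0 : E) ∈ s := by
  induction n with
  | zero =>
    intro E _ _ _ hn s _ f hf _ _
    have := Module.finrank_zero_iff.1 hn
    obtain ⟨x, hx⟩ := hf.exists
    rwa [Subsingleton.elim (0 : E) (f x)]
  | succ n ih =>
    intro E _ _ _ hn s hs f hf hfi hf0
    by_contra h0
    obtain ⟨x₀, hx₀⟩ := hf.exists
    obtain ⟨l, hl, hls⟩ := hs.exists_ne_zero_forall_nonpos ⟨_, hx₀⟩ h0
    have hlf : ∀ᵐ x ∂μ, l (f x) = 0 := by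
      have h1 : ∫ x, -l (f x) ∂μ = 0 := by
        rw [integral_neg, l.integral_comp_comm hfi, hf0, map_zero, neg_zero]
      have h2 := (integral_eq_zero_iff_of_nonneg_ae
        (hf.mono fun x hx => by simpa using hls _ hx) (l.integrable_comp hfi).neg).1 h1
      filter_upwards [h2] with x hx
      simpa using hx
    let K : Submodule ℝ E := LinearMap.ker (l : E →ₗ[ℝ] ℝ)
    have hK : Module.finrank ℝ K = n := by
      have h1 := LinearMap.finrank_range_add_finrank_ker (l : E →ₗ[ℝ] ℝ)
      have h2 : LinearMap.range (l : E →ₗ[ℝ] ℝ) = ⊤ :=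
        LinearMap.range_eq_top.2 (LinearMap.surjective fun h => hl (ContinuousLinearMap.coe_injective h))
      rw [h2, finrank_top, Module.finrank_self, hn] at h1
      change 1 + Module.finrank ℝ K = n + 1 at h1
      omega
    -- Composing with a projection onto `K` turns `f` into a `K`-valued map, changing it only on a
    -- null set.
    obtain ⟨P, hP⟩ := LinearMap.exists_leftInverse_of_injective K.subtype K.ker_subtype
    let P' : E →L[ℝ] K := LinearMap.toContinuousLinearMap P
    have hP' : ∀ x : E, l x = 0 → ((P' x : K) : E) = x := fun x hx =>
      congrArg Subtype.val (LinearMap.congr_fun hP ⟨x, hx⟩)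
    refine h0 (ih K hK (K.subtype ⁻¹' s) (hs.linear_preimage K.subtype) (fun x => P' (f x)) ?_
      (P'.integrable_comp hfi) ?_)
    · filter_upwards [hf, hlf] with x hx hx'
      change ((P' (f x) : K) : E) ∈ s
      rwa [hP' _ hx']
    · rw [P'.integral_comp_comm hfi, hf0, map_zero]

/-- In finite dimension the expectation of a random vector with values in a convex set lies in
that set, even if the set is not closed. -/
theorem Convex.integral_mem_of_finiteDimensional {Ω : Type*} [MeasurableSpace Ω] {μ : Measure Ω}
    [IsProbabilityMeasure μ] {s : Set E} (hs : Convex ℝ s) {f : Ω → E} (hf : ∀ᵐ x ∂μ, f x ∈ s)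
    (hfi : Integrable f μ) : ∫ x, f x ∂μ ∈ s := by
  set m := ∫ x, f x ∂μ with hm
  have h := Convex.zero_mem_of_integral_eq_zero (μ := μ) _ E rfl ((fun x => x + m) ⁻¹' s)
    (hs.translate_preimage_left m) (fun x => f x - m) (hf.mono fun x hx => by simpa using hx)
    (hfi.sub (integrable_const m)) (by
      rw [integral_sub hfi (integrable_const m)]; simp [hm])
  simpa using h

end ConvexIntegral

/-! ### Reduction to three atoms with prescribed moments -/

section AtomReduction

/-- A finitely supported weight on the real line can be concentrated on at most three of its points
without changing its first three moments and without decreasing the integral of a given function. -/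
theorem exists_card_le_three_weights (φ : ℝ → ℝ) : ∀ (n : ℕ) (S : Finset ℝ) (w : ℝ → ℝ),
    S.card = n → (∀ t ∈ S, 0 ≤ w t) → ∃ S' ⊆ S, ∃ w' : ℝ → ℝ, S'.card ≤ 3 ∧
      (∀ t ∈ S', 0 < w' t) ∧ ∑ t ∈ S', w' t = ∑ t ∈ S, w t ∧
      ∑ t ∈ S', w' t * t = ∑ t ∈ S, w t * t ∧ ∑ t ∈ S', w' t * t ^ 2 = ∑ t ∈ S, w t * t ^ 2 ∧
      ∑ t ∈ S, w t * φ t ≤ ∑ t ∈ S', w' t * φ t := by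
  intro n
  induction n with
  | zero =>
    intro S w hS _
    rw [Finset.card_eq_zero] at hS
    subst hS
    exact ⟨∅, subset_rfl, w, by simp⟩
  | succ n ih =>
    intro S w hS hw
    have drop : ∀ v : ℝ → ℝ, (∀ t ∈ S, 0 ≤ v t) → (∃ t ∈ S, v t = 0) →
        ∃ S' ⊆ S, ∃ w' : ℝ → ℝ, S'.card ≤ 3 ∧
        (∀ t ∈ S', 0 < w' t) ∧ ∑ t ∈ S', w' t = ∑ t ∈ S, v t ∧
        ∑ t ∈ S', w' t * t = ∑ t ∈ S, v t * t ∧ ∑ t ∈ S', w' t * t ^ 2 = ∑ t ∈ S, v t * t ^ 2 ∧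
        ∑ t ∈ S, v t * φ t ≤ ∑ t ∈ S', w' t * φ t := by
      rintro v hv ⟨t, ht, hvt⟩
      obtain ⟨S', hS', w', h1, h2, h3, h4, h5, h6⟩ := ih (S.erase t) v
        (by rw [Finset.card_erase_of_mem ht, hS]; rfl) (fun u hu => hv u (Finset.mem_of_mem_erase hu))
      refine ⟨S', hS'.trans (Finset.erase_subset _ _), w', h1, h2, ?_, ?_, ?_, ?_⟩
      · rw [h3, Finset.sum_erase _ hvt]
      · rw [h4, Finset.sum_erase _ (by simp [hvt])]
      · rw [h5, Finset.sum_erase _ (by simp [hvt])]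
      · rwa [Finset.sum_erase _ (by simp [hvt])] at h6
    by_cases hz : ∃ t ∈ S, w t = 0
    · exact drop w hw hz
    push Not at hz
    have hpos : ∀ t ∈ S, 0 < w t := fun t ht => lt_of_le_of_ne (hw t ht) (hz t ht).symm
    by_cases hcard : S.card ≤ 3
    · exact ⟨S, subset_rfl, w, hcard, hpos, rfl, rfl, rfl, le_rfl⟩
    -- More than three points `(t, t²)` in the plane are affinely dependent. The sign of the
    -- dependence is chosen so that moving along it does not lower the objective.
    have hrel : ∃ g : ℝ → ℝ, ∑ t ∈ S, g t = 0 ∧ ∑ t ∈ S, g t * t = 0 ∧ ∑ t ∈ S, g t * t ^ 2 = 0 ∧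
        (∃ t ∈ S, g t ≠ 0) ∧ 0 ≤ ∑ t ∈ S, g t * φ t := by
      let e : ℝ ↪ ℝ × ℝ := ⟨fun t => (t, t ^ 2), fun x y hxy => congrArg Prod.fst hxy⟩
      obtain ⟨g, hg1, hg0, x, hx, hgx⟩ :=
        Module.exists_nontrivial_relation_sum_zero_of_finrank_succ_lt_card (R := ℝ) (t := S.map e)
          (by rw [Finset.card_map]; simp; omega)
      rw [Finset.sum_map] at hg1 hg0
      obtain ⟨t, ht, rfl⟩ := Finset.mem_map.1 hx
      have h1 : ∑ t ∈ S, g (e t) * t = 0 := by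
        have := congrArg Prod.fst hg1
        rwa [Prod.fst_sum] at this
      have h2 : ∑ t ∈ S, g (e t) * t ^ 2 = 0 := by
        have := congrArg Prod.snd hg1
        rwa [Prod.snd_sum] at this
      rcases le_total 0 (∑ t ∈ S, g (e t) * φ t) with h | h
      · exact ⟨fun t => g (e t), hg0, h1, h2, ⟨t, ht, hgx⟩, h⟩
      · exact ⟨fun t => -g (e t), by simp [hg0], by simp [h1], by simp [h2], ⟨t, ht, by simpa⟩,
          by simpa using h⟩
    obtain ⟨g, hg0, hg1, hg2, ⟨t₀, ht₀, hgt₀⟩, hgφ⟩ := hrel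
    obtain ⟨t₁, ht₁, hneg⟩ : ∃ t ∈ S, g t < 0 := by
      by_contra! hcon
      exact hgt₀ ((Finset.sum_eq_zero_iff_of_nonneg hcon).1 hg0 t₀ ht₀)
    -- Ratio test: `r` is the largest step along `g` that keeps all weights non-negative, and it
    -- makes the weight at `u` vanish.
    obtain ⟨u, hu, hmin⟩ := Finset.exists_min_image (S.filter fun t => g t < 0)
      (fun t => w t / -g t) ⟨t₁, by simp [ht₁, hneg]⟩
    rw [Finset.mem_filter] at hu
    obtain ⟨huS, hgu⟩ := hu
    set r := w u / -g u with hr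
    have hr0 : 0 ≤ r := div_nonneg (hw u huS) (by linarith)
    have hsum : ∀ ψ : ℝ → ℝ, ∑ t ∈ S, (w t + r * g t) * ψ t =
        ∑ t ∈ S, w t * ψ t + r * ∑ t ∈ S, g t * ψ t := by
      intro ψ
      rw [Finset.mul_sum, ← Finset.sum_add_distrib]
      exact Finset.sum_congr rfl fun t _ => by ring
    obtain ⟨S', hS', w', h1, h2, h3, h4, h5, h6⟩ := drop (fun t => w t + r * g t) (fun t ht => by
        rcases lt_or_ge (g t) 0 with h | h
        · have := hmin t (by simp [ht, h])
          rw [le_div_iff₀ (by linarith)] at this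
          linarith
        · have := hw t ht
          positivity) ⟨u, huS, by have := hgu.ne; rw [hr]; field_simp; ring⟩
    refine ⟨S', hS', w', h1, h2, ?_, ?_, ?_, ?_⟩
    · rw [h3, Finset.sum_add_distrib, ← Finset.mul_sum, hg0, mul_zero, add_zero]
    · rw [h4, hsum fun t => t, hg1, mul_zero, add_zero]
    · rw [h5, hsum fun t => t ^ 2, hg2, mul_zero, add_zero]
    · rw [hsum] at h6
      have := mul_nonneg hr0 hgφ
      linarith

end AtomReduction

/-! ### Tent functions and their superpositions -/

section Tents

/-- The tent function with apex on the left and vanishing point `t`. -/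
def tent (t x : ℝ) : ℝ := max (t - x) 0

theorem tent_nonneg (t x : ℝ) : 0 ≤ tent t x := le_max_right _ _

theorem tent_of_le {t x : ℝ} (h : x ≤ t) : tent t x = t - x := max_eq_left (by linarith)

theorem tent_of_ge {t x : ℝ} (h : t ≤ x) : tent t x = 0 := max_eq_right (by linarith)

theorem continuous_tent (t : ℝ) : Continuous (tent t) := by unfold tent; fun_prop

theorem convexOn_tent (t : ℝ) (s : Set ℝ) (hs : Convex ℝ s) : ConvexOn ℝ s (tent t) := by
  have h1 : ConvexOn ℝ s fun x : ℝ => t - x :=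
    (convexOn_const t hs).sub (concaveOn_id hs)
  exact h1.sup (convexOn_const 0 hs)

theorem integrableOn_tent (a t : ℝ) : IntegrableOn (tent t) (Ici a) := by
  have h1 : IntegrableOn (tent t) (Icc a t) :=
    (continuous_tent t).continuousOn.integrableOn_compact isCompact_Icc
  have h2 : IntegrableOn (tent t) (Ioi t) :=
    (integrableOn_zero (s := Ioi t) (μ := volume) (ε' := ℝ)).congr_fun
      (fun x hx => (tent_of_ge (le_of_lt hx)).symm) measurableSet_Ioi
  refine (h1.union h2).mono_set fun x hx => ?_
  rcases le_or_gt x t with h | h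
  · exact Or.inl ⟨hx, h⟩
  · exact Or.inr h

theorem integrableOn_mul_tent (a t : ℝ) {h : ℝ → ℝ} (hm : Measurable h)
    (hb : ∃ M : ℝ, ∀ x, |h x| ≤ M) : IntegrableOn (fun x => h x * tent t x) (Ici a) := by
  obtain ⟨M, hM⟩ := hb
  exact (integrableOn_tent a t).bdd_mul hm.aestronglyMeasurable
    (ae_of_all _ fun x => by simpa using hM x)

theorem hasDerivWithinAt_tent {a t : ℝ} (hat : a ≤ t) :
    ∃ s : ℝ, HasDerivWithinAt (tent t) s (Ioi a) a ∧ -1 ≤ s := by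
  rcases hat.eq_or_lt with rfl | hlt
  · refine ⟨0, ?_, by norm_num⟩
    exact (hasDerivWithinAt_const a (Ioi a) (0 : ℝ)).congr
      (fun x hx => tent_of_ge (le_of_lt hx)) (tent_of_ge le_rfl)
  · refine ⟨-1, ?_, le_rfl⟩
    have h1 : HasDerivAt (fun x : ℝ => t - x) (-1) a := by
      simpa using (hasDerivAt_id a).const_sub t
    refine (h1.congr_of_eventuallyEq ?_).hasDerivWithinAt
    filter_upwards [eventually_lt_nhds hlt] with x hx
    exact tent_of_le hx.le

/-- The objective value of a single tent. -/
noncomputable def tentObjective (a : ℝ) (h : ℝ → ℝ) (t : ℝ) : ℝ := ∫ x in Ici a, h x * tent t x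

theorem tentObjective_eq_intervalIntegral {a t : ℝ} (hat : a ≤ t) (h : ℝ → ℝ) :
    tentObjective a h t = ∫ x in a..t, h x * (t - x) := by
  rw [tentObjective, intervalIntegral.integral_of_le hat, integral_Ici_eq_integral_Ioi]
  refine (setIntegral_eq_of_subset_of_forall_sdiff_eq_zero measurableSet_Ioi
    (fun x hx => hx.1) fun x hx => ?_).trans
    (setIntegral_congr_fun measurableSet_Ioc fun x hx => ?_)
  · rw [tent_of_ge, mul_zero]
    by_contra hcon
    exact hx.2 ⟨hx.1, (not_le.1 hcon).le⟩
  · simp only [tent_of_le hx.2]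

theorem integral_tent {a t : ℝ} (hat : a ≤ t) : ∫ x in Ici a, tent t x = (t - a) ^ 2 / 2 := by
  have h1 := tentObjective_eq_intervalIntegral hat fun _ => 1
  simp only [tentObjective, one_mul] at h1
  rw [h1, intervalIntegral.integral_sub (by simp) (by simp)]
  simp
  ring

/-- For `t ≥ a` the value is `t ∫_a^t h - ∫_a^t h x * x`, built from primitives of locally
integrable functions. -/
theorem continuousOn_tentObjective (a : ℝ) {h : ℝ → ℝ} (hm : Measurable h)
    (hb : ∃ M : ℝ, ∀ x, |h x| ≤ M) : ContinuousOn (tentObjective a h) (Ici a) := by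
  obtain ⟨M, hM⟩ := hb
  have hi : ∀ u v, IntervalIntegrable h volume u v := fun u v =>
    (intervalIntegrable_const (c := M)).mono_fun hm.aestronglyMeasurable
      (ae_of_all _ fun x => by simpa using (hM x).trans (le_abs_self M))
  have hi' : ∀ u v, IntervalIntegrable (fun x => h x * x) volume u v := fun u v =>
    (hi u v).mul_continuousOn continuousOn_id
  have hc : Continuous fun t => t * (∫ x in a..t, h x) - ∫ x in a..t, h x * x :=
    (continuous_id.mul (intervalIntegral.continuous_primitive hi a)).sub
      (intervalIntegral.continuous_primitive hi' a)
  refine hc.continuousOn.congr fun t ht => ?_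
  beta_reduce
  rw [tentObjective_eq_intervalIntegral ht, ← intervalIntegral.integral_const_mul,
    ← intervalIntegral.integral_sub ((hi a t).const_mul t) (hi' a t)]
  exact intervalIntegral.integral_congr fun x _ => by ring

/-- The superposition of tents ending at the points `t i`, with weights `w i`. -/
def tents {ι : Type*} [Fintype ι] (t w : ι → ℝ) (x : ℝ) : ℝ := ∑ i, w i * tent (t i) x

variable {ι : Type*} [Fintype ι]

theorem continuous_tents (t w : ι → ℝ) : Continuous (tents t w) :=
  continuous_finsetSum _ fun i _ => (continuous_tent (t i)).const_mul (w i)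

theorem tents_nonneg {t w : ι → ℝ} (hw : ∀ i, 0 ≤ w i) (x : ℝ) : 0 ≤ tents t w x :=
  Finset.sum_nonneg fun i _ => mul_nonneg (hw i) (tent_nonneg _ _)

theorem objective_tents (a : ℝ) {h : ℝ → ℝ} (hm : Measurable h) (hb : ∃ M : ℝ, ∀ x, |h x| ≤ M)
    (t w : ι → ℝ) : objective a h (tents t w) = ∑ i, w i * tentObjective a h (t i) := by
  simp only [objective, tents, tentObjective, Finset.mul_sum]
  rw [integral_finsetSum _ fun i _ => ?_]
  · refine Finset.sum_congr rfl fun i _ => ?_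
    rw [← integral_const_mul]
    exact integral_congr_ae (ae_of_all _ fun x => by simp only; ring)
  · refine ((integrableOn_mul_tent a (t i) hm hb).const_mul (w i)).congr
      (ae_of_all _ fun x => by simp only; ring)

theorem integral_tents {a : ℝ} {t : ι → ℝ} (ht : ∀ i, a ≤ t i) (w : ι → ℝ) :
    ∫ x in Ici a, tents t w x = ∑ i, w i * ((t i - a) ^ 2 / 2) := by
  have h1 := objective_tents a (h := fun _ => 1) measurable_const ⟨1, by simp⟩ t w
  simpa [objective, tentObjective, integral_tent, ht] using h1

/-- The moment conditions on the weights that make a superposition of tents feasible. -/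
structure IsFeasibleAtoms (a βl βu ηl ηu νu : ℝ) (t w : ι → ℝ) : Prop where
  le_pos : ∀ i, a ≤ t i
  weight_nonneg : ∀ i, 0 ≤ w i
  weight_le : ∑ i, w i ≤ νu
  value_ge : ηl ≤ ∑ i, w i * (t i - a)
  value_le : ∑ i, w i * (t i - a) ≤ ηu
  mass_ge : βl ≤ ∑ i, w i * ((t i - a) ^ 2 / 2)
  mass_le : ∑ i, w i * ((t i - a) ^ 2 / 2) ≤ βu

theorem IsFeasibleAtoms.isFeasible {a βl βu ηl ηu νu : ℝ} {t w : ι → ℝ}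
    (H : IsFeasibleAtoms a βl βu ηl ηu νu t w) : IsFeasible a βl βu ηl ηu νu (tents t w) := by
  have hval : tents t w a = ∑ i, w i * (t i - a) :=
    Finset.sum_congr rfl fun i _ => by rw [tent_of_le (H.le_pos i)]
  refine ⟨?_, ?_, ?_, ?_, ?_, ?_, ?_, ?_, fun x _ => tents_nonneg H.weight_nonneg x⟩
  · exact integrable_finsetSum _ fun i _ => (integrableOn_tent a (t i)).const_mul (w i)
  · rw [integral_tents H.le_pos]; exact H.mass_ge
  · rw [integral_tents H.le_pos]; exact H.mass_le
  · exact (continuous_tents t w).continuousWithinAt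
  · rw [hval]; exact H.value_ge
  · rw [hval]; exact H.value_le
  · choose s hs hs' using fun i => hasDerivWithinAt_tent (H.le_pos i)
    refine ⟨∑ i, w i * s i, HasDerivWithinAt.fun_sum fun i _ => (hs i).const_mul (w i), ?_⟩
    have h1 : ∑ i, w i * (-1) ≤ ∑ i, w i * s i :=
      Finset.sum_le_sum fun i _ => mul_le_mul_of_nonneg_left (hs' i) (H.weight_nonneg i)
    have h2 := H.weight_le
    simp only [mul_neg, mul_one, Finset.sum_neg_distrib] at h1
    linarith
  · have h1 : ∀ S : Finset ι, ConvexOn ℝ (Ici a) fun x => ∑ i ∈ S, w i * tent (t i) x := by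
      classical
      intro S
      induction S using Finset.induction_on with
      | empty => simpa using convexOn_const (0 : ℝ) (convex_Ici a)
      | insert i S hi ih =>
        simp only [Finset.sum_insert hi]
        exact ((convexOn_tent (t i) _ (convex_Ici a)).smul (H.weight_nonneg i)).add ih
    exact h1 Finset.univ

/-- On each segment only the tents ending at or after its right endpoint contribute, so the
coefficients are tail sums of `w i * t i` and of `-w i`. -/
theorem hasSegments_tents {a : ℝ} {t w : Fin 3 → ℝ} (h0 : a ≤ t 0) (h1 : t 0 ≤ t 1)
    (h2 : t 1 ≤ t 2) : HasSegments a 3 (tents t w) ![a, t 0, t 1, t 2]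
      ![w 0 * t 0 + w 1 * t 1 + w 2 * t 2, w 1 * t 1 + w 2 * t 2, w 2 * t 2]
      ![-(w 0 + w 1 + w 2), -(w 1 + w 2), -(w 2)] := by
  refine ⟨rfl, ?_, ?_, ?_⟩
  · refine Fin.monotone_iff_le_succ.2 fun i => ?_
    fin_cases i <;> simpa
  · intro j x hx
    simp only [tents, Fin.sum_univ_three]
    fin_cases j
    · obtain ⟨hx1, hx2⟩ : a ≤ x ∧ x ≤ t 0 := by simpa using hx
      rw [tent_of_le hx2, tent_of_le (hx2.trans h1), tent_of_le (hx2.trans (h1.trans h2))]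
      simp; ring
    · obtain ⟨hx1, hx2⟩ : t 0 ≤ x ∧ x ≤ t 1 := by simpa using hx
      rw [tent_of_ge hx1, tent_of_le hx2, tent_of_le (hx2.trans h2)]
      simp; ring
    · obtain ⟨hx1, hx2⟩ : t 1 ≤ x ∧ x ≤ t 2 := by simpa using hx
      rw [tent_of_ge (h1.trans hx1), tent_of_ge hx1, tent_of_le hx2]
      simp; ring
  · intro x hx
    have hx' : t 2 < x := by simpa [Fin.last] using hx
    simp only [tents, Fin.sum_univ_three]
    rw [tent_of_ge (by linarith), tent_of_ge (by linarith), tent_of_ge hx'.le]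
    simp

theorem tents_mem_PLPlus {a : ℝ} {t w : Fin 3 → ℝ} (h0 : a ≤ t 0) (h1 : t 0 ≤ t 1)
    (h2 : t 1 ≤ t 2) (hw : ∀ i, 0 ≤ w i) : tents t w ∈ PLPlus 3 a :=
  ⟨(continuous_tents t w).continuousOn, fun x _ => tents_nonneg hw x, _, _, _,
    hasSegments_tents h0 h1 h2⟩

end Tents

/-! ### Convex integrable functions as mixtures of tents -/

section ConvexTail

variable {a : ℝ} {f : ℝ → ℝ}

/-- After a strict rise from `x` to `y`, convexity keeps `f` above the positive constant `f y` on
`(y, ∞)`, contradicting integrability. -/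
theorem ConvexOn.antitoneOn_of_integrableOn_Ici (hf : ConvexOn ℝ (Ici a) f)
    (h0 : ∀ x ∈ Ici a, 0 ≤ f x) (hi : IntegrableOn f (Ici a)) : AntitoneOn f (Ici a) := by
  intro x hx y hy hxy
  by_contra! hlt
  have hxy' : x < y := lt_of_le_of_ne hxy (by rintro rfl; exact lt_irrefl _ hlt)
  have hy0 : 0 < f y := (h0 x hx).trans_lt hlt
  have hge : ∀ z ∈ Ioi y, f y ≤ f z := by
    intro z hz
    have hmem : y ∈ openSegment ℝ x z := by
      rw [openSegment_eq_Ioo (hxy'.trans hz)]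
      exact ⟨hxy', hz⟩
    exact (hf.lt_right_of_left_lt hx (hy.out.trans hz.out.le) hmem hlt).le
  have hc : IntegrableOn (fun _ : ℝ => f y) (Ioi y) := by
    refine Integrable.mono' (hi.mono_set fun z hz => hy.out.trans hz.out.le)
      aestronglyMeasurable_const ?_
    filter_upwards [ae_restrict_mem measurableSet_Ioi] with z hz
    simpa [abs_of_pos hy0] using hge z hz
  rw [integrableOn_const_iff] at hc
  simp [hy0.ne'] at hc

/-- Monotonicity gives `(z - a) * f z ≤ ∫_a^z f`, which is at most the total mass. -/
theorem AntitoneOn.tendsto_zero_of_integrableOn_Ici (hf : AntitoneOn f (Ici a))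
    (h0 : ∀ x ∈ Ici a, 0 ≤ f x) (hi : IntegrableOn f (Ici a)) : Tendsto f atTop (𝓝 0) := by
  have hle : ∀ z, a < z → f z ≤ (∫ x in Ici a, f x) / (z - a) := by
    intro z hz
    rw [le_div_iff₀ (by linarith)]
    have hsub : Ioc a z ⊆ Ici a := fun x hx => hx.1.le
    have h1 : ∫ x in Ioc a z, f z ≤ ∫ x in Ioc a z, f x :=
      setIntegral_mono_on (by simp) (hi.mono_set hsub) measurableSet_Ioc
        fun x hx => hf (hsub hx) hz.le hx.2
    have h2 : ∫ x in Ioc a z, f x ≤ ∫ x in Ici a, f x :=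
      setIntegral_mono_set hi ((ae_restrict_mem measurableSet_Ici).mono h0) hsub.eventuallyLE
    simp [hz.le] at h1
    linarith
  have hlim : Tendsto (fun z => (∫ x in Ici a, f x) / (z - a)) atTop (𝓝 0) :=
    tendsto_const_nhds.div_atTop (tendsto_atTop_add_const_right _ (-a) tendsto_id)
  refine tendsto_of_tendsto_of_tendsto_of_le_of_le' tendsto_const_nhds hlim ?_ ?_
  · filter_upwards [eventually_ge_atTop a] with z hz using h0 z hz
  · filter_upwards [eventually_gt_atTop a] with z hz using hle z hz

/-- The right slope of an integrable non-negative convex function, with the sign reversed, is a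
non-negative antitone density of its increments. -/
theorem IsFeasible.exists_antitone_density {βl βu ηl ηu νu : ℝ}
    (H : IsFeasible a βl βu ηl ηu νu f) : ∃ p : ℝ → ℝ, AntitoneOn p (Ioi a) ∧
      (∀ u ∈ Ioi a, 0 ≤ p u) ∧ (∀ u ∈ Ioi a, p u ≤ νu) ∧ (∀ u ∈ Ioi a, p u * (u - a) ≤ f a) ∧
      ∀ x ∈ Ici a, IntegrableOn p (Ioi x) ∧ ∫ u in Ioi x, p u = f x := by
  have hanti := H.convex.antitoneOn_of_integrableOn_Ici H.nonneg H.integrable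
  have hlim := hanti.tendsto_zero_of_integrableOn_Ici H.nonneg H.integrable
  have hint : ∀ u ∈ Ioi a, u ∈ interior (Ici a) := fun u hu => by rwa [interior_Ici]
  have hder : ∀ u ∈ Ioi a, HasDerivWithinAt f (derivWithin f (Ioi u) u) (Ioi u) u :=
    fun u hu => H.convex.hasDerivWithinAt_rightDeriv_of_mem_interior (hint u hu)
  have hslope : ∀ u ∈ Ioi a, slope f a u ≤ derivWithin f (Ioi u) u := fun u hu =>
    (H.convex.slope_le_leftDeriv_of_mem_interior self_mem_Ici (hint u hu) hu).trans
      (H.convex.leftDeriv_le_rightDeriv_of_mem_interior (hint u hu))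
  have hpanti : AntitoneOn (fun u => -derivWithin f (Ioi u) u) (Ioi a) := by
    have := H.convex.monotoneOn_rightDeriv
    rw [interior_Ici] at this
    exact this.neg
  have hp0 : ∀ u ∈ Ioi a, 0 ≤ -derivWithin f (Ioi u) u := by
    intro u hu
    have h1 : u < u + 1 := by linarith
    have h2 := H.convex.rightDeriv_le_slope_of_mem_interior (hint u hu)
      (hu.out.le.trans h1.le) h1
    have h3 := hanti hu.out.le (hu.out.le.trans h1.le : a ≤ u + 1) h1.le
    rw [slope_def_field] at h2
    simp at h2
    linarith
  have hpν : ∀ u ∈ Ioi a, -derivWithin f (Ioi u) u ≤ νu := by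
    intro u hu
    obtain ⟨s, hs, hs'⟩ := H.slope_ge
    have h1 := H.convex.le_slope_of_hasDerivWithinAt_Ioi self_mem_Ici hu.out.le hu hs
    linarith [hslope u hu]
  refine ⟨fun u => -derivWithin f (Ioi u) u, hpanti, hp0, hpν, ?_, ?_⟩
  · intro u hu
    have h1 := hslope u hu
    have hu' : 0 < u - a := sub_pos.2 hu
    rw [slope_def_field, div_le_iff₀ hu'] at h1
    have := H.nonneg u hu.out.le
    linarith
  · intro x hx
    have hcont : ContinuousOn f (Ici a) := by
      intro y hy
      rcases hy.out.eq_or_lt with rfl | hlt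
      · rw [← continuousWithinAt_Ioi_iff_Ici]
        exact H.right_continuous
      · have h1 := H.convex.continuousOn_interior
        rw [interior_Ici] at h1
        exact (h1.continuousAt (Ioi_mem_nhds hlt)).continuousWithinAt
    have hmeas : AEMeasurable (fun u => -derivWithin f (Ioi u) u) (volume.restrict (Ioi a)) :=
      aemeasurable_restrict_of_antitoneOn measurableSet_Ioi hpanti
    have hsub : ∀ y, Ioc x y ⊆ Ioi a := fun y u hu => lt_of_le_of_lt hx hu.1
    have hii : ∀ y, IntegrableOn (fun u => -derivWithin f (Ioi u) u) (Ioc x y) := by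
      intro y
      refine Integrable.mono' (g := fun _ => νu) (by simp)
        (hmeas.mono_measure (Measure.restrict_mono (hsub y) le_rfl)).aestronglyMeasurable ?_
      filter_upwards [ae_restrict_mem measurableSet_Ioc] with u hu
      rw [Real.norm_of_nonneg (hp0 u (hsub y hu))]
      exact hpν u (hsub y hu)
    have hftc : ∀ y, x ≤ y → ∫ u in x..y, -derivWithin f (Ioi u) u = f x - f y := by
      intro y hxy
      have := intervalIntegral.integral_eq_sub_of_hasDeriv_right_of_le hxy (f := fun u => -f u)
        (f' := fun u => -derivWithin f (Ioi u) u)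
        (hcont.mono fun u hu => hx.out.trans hu.1).neg
        (fun u hu => (hder u (lt_of_le_of_lt hx hu.1)).neg)
        ((intervalIntegrable_iff_integrableOn_Ioc_of_le hxy).2 (hii y))
      rw [this]; ring
    have hlim' : Tendsto (fun y => ∫ u in x..y, -derivWithin f (Ioi u) u) atTop (𝓝 (f x)) := by
      have h1 : Tendsto (fun y => f x - f y) atTop (𝓝 (f x - 0)) := hlim.const_sub (f x)
      rw [sub_zero] at h1
      refine h1.congr' ?_
      filter_upwards [eventually_ge_atTop x] with y hy using (hftc y hy).symm
    have hI : IntegrableOn (fun u => -derivWithin f (Ioi u) u) (Ioi x) := by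
      refine integrableOn_Ioi_of_intervalIntegral_norm_tendsto (f x) x hii tendsto_id
        (hlim'.congr' ?_)
      filter_upwards [eventually_ge_atTop x] with y hy
      refine intervalIntegral.integral_congr_ae (ae_of_all _ fun u hu => ?_)
      rw [uIoc_of_le hy] at hu
      exact (Real.norm_of_nonneg (hp0 u (hsub y hu))).symm
    exact ⟨hI, tendsto_nhds_unique (intervalIntegral_tendsto_integral_Ioi x hI tendsto_id) hlim'⟩

/-- A feasible function is a superposition of tents: the tent with slope level `s` ends at the
point where the slope of `f` passes `-s`. -/
theorem IsFeasible.exists_tent_representation {βl βu ηl ηu νu : ℝ} (hνu : 0 < νu)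
    (H : IsFeasible a βl βu ηl ηu νu f) : ∃ T : ℝ → ℝ,
      AEMeasurable T (volume.restrict (Ioc 0 νu)) ∧ (∀ s ∈ Ioc 0 νu, a ≤ T s) ∧
      ∀ x ∈ Ici a, ∫⁻ s in Ioc 0 νu, ENNReal.ofReal (tent (T s) x) = ENNReal.ofReal (f x) := by
  obtain ⟨p, hanti, hp0, hpν, hpb, hpi⟩ := H.exists_antitone_density
  -- Inserting `a` keeps the set nonempty and makes `T s = a`, a tent vanishing on `[a, ∞)`, when no
  -- slope exceeds `s`.
  let A : ℝ → Set ℝ := fun s => insert a {u | a < u ∧ s < p u}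
  let T : ℝ → ℝ := fun s => sSup (A s)
  have hne : ∀ s, (A s).Nonempty := fun s => insert_nonempty _ _
  have hbdd : ∀ s, 0 < s → BddAbove (A s) := by
    intro s hs
    refine ⟨a + f a / s, ?_⟩
    rintro u (rfl | ⟨hu, hsu⟩)
    · have := div_nonneg (H.nonneg u self_mem_Ici) hs.le
      linarith
    · have h1 := hpb u hu
      have h2 : s * (u - a) ≤ p u * (u - a) :=
        mul_le_mul_of_nonneg_right hsu.le (sub_nonneg.2 hu.le)
      have h3 : u - a ≤ f a / s := by rw [le_div_iff₀ hs]; linarith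
      linarith
  have haT : ∀ s ∈ Ioc 0 νu, a ≤ T s := fun s hs => le_csSup (hbdd s hs.1) (mem_insert _ _)
  have hTanti : AntitoneOn T (Ioi 0) := by
    intro s hs r hr hsr
    refine csSup_le_csSup (hbdd s hs) (hne r) (insert_subset_insert ?_)
    exact fun u hu => ⟨hu.1, hsr.trans_lt hu.2⟩
  have hTν : ∀ s, νu < s → T s = a := by
    intro s hs
    have : A s = {a} := by
      have h1 : {u | a < u ∧ s < p u} = ∅ :=
        eq_empty_of_forall_notMem fun u hu => (hs.trans hu.2).not_ge (hpν u hu.1)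
      simp only [A, h1, insert_empty_eq]
    simp [T, this]
  -- As `p` is antitone, its superlevel set beyond `x` is an interval from `x` to `T s`, up to the
  -- right endpoint, which has measure zero.
  have hmeas : ∀ x ∈ Ici a, ∀ s, 0 < s →
      (volume.restrict (Ioi x)) {u | s < p u} = ENNReal.ofReal (tent (T s) x) := by
    intro x hx s hs
    have h1 : Ioo x (T s) ⊆ {u | s < p u} ∩ Ioi x := by
      rintro u ⟨hxu, huT⟩
      refine ⟨?_, hxu⟩
      obtain ⟨v, hv, huv⟩ := exists_lt_of_lt_csSup (hne s) huT
      have hau : a < u := lt_of_le_of_lt hx hxu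
      rcases hv with rfl | ⟨hav, hsv⟩
      · exact absurd huv hau.not_gt
      · exact hsv.trans_le (hanti hau hav huv.le)
    have h2 : {u | s < p u} ∩ Ioi x ⊆ Ioc x (T s) := fun u hu =>
      ⟨hu.2, le_csSup (hbdd s hs) (Or.inr ⟨lt_of_le_of_lt hx hu.2, hu.1⟩)⟩
    have h3 : ENNReal.ofReal (tent (T s) x) = ENNReal.ofReal (T s - x) := by
      rw [tent, ENNReal.ofReal_max, ENNReal.ofReal_zero, max_eq_left zero_le]
    rw [Measure.restrict_apply' measurableSet_Ioi, h3]
    apply le_antisymm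
    · simpa using measure_mono (μ := volume) h2
    · simpa using measure_mono (μ := volume) h1
  refine ⟨T, ?_, haT, ?_⟩
  · exact (aemeasurable_restrict_of_antitoneOn measurableSet_Ioi hTanti).mono_measure
      (Measure.restrict_mono Ioc_subset_Ioi_self le_rfl)
  · intro x hx
    have hpx : ∀ᵐ u ∂(volume.restrict (Ioi x)), 0 ≤ p u := by
      filter_upwards [ae_restrict_mem measurableSet_Ioi] with u hu
      exact hp0 u (lt_of_le_of_lt hx.out hu.out)
    obtain ⟨hI, hval⟩ := hpi x hx
    -- Layer cake formula for `p` on `(x, ∞)`; the levels above `νu` contribute nothing.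
    rw [← hval, ofReal_integral_eq_lintegral_ofReal hI hpx,
      lintegral_eq_lintegral_meas_lt _ hpx hI.aemeasurable, ← Ioc_union_Ioi_eq_Ioi hνu.le,
      lintegral_union measurableSet_Ioi (Ioc_disjoint_Ioi le_rfl)]
    rw [setLIntegral_congr_fun measurableSet_Ioc fun s hs => hmeas x hx s hs.1,
      setLIntegral_congr_fun measurableSet_Ioi fun s hs => hmeas x hx s (hνu.trans hs)]
    have : ∫⁻ s in Ioi νu, ENNReal.ofReal (tent (T s) x) = 0 := by
      refine (setLIntegral_congr_fun measurableSet_Ioi (g := fun _ => 0) fun s hs => ?_).trans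
        (by simp)
      simp only [hTν s hs, tent_of_ge hx.out, ENNReal.ofReal_zero]
    rw [this, add_zero]

end ConvexTail

/-! ### Exchanging the mixture with integration in `x` -/

section TentFubini

variable {a : ℝ} {f T : ℝ → ℝ} {μ : Measure ℝ}

theorem integral_tent_representation (hT : AEMeasurable T μ) (h0 : ∀ x ∈ Ici a, 0 ≤ f x)
    (hrep : ∀ x ∈ Ici a, ∫⁻ s, ENNReal.ofReal (tent (T s) x) ∂μ = ENNReal.ofReal (f x))
    {x : ℝ} (hx : x ∈ Ici a) : Integrable (fun s => tent (T s) x) μ ∧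
      ∫ s, tent (T s) x ∂μ = f x := by
  have hm : AEStronglyMeasurable (fun s => tent (T s) x) μ :=
    ((hT.sub_const x).max aemeasurable_const).aestronglyMeasurable
  refine ⟨⟨hm, ?_⟩, ?_⟩
  · rw [hasFiniteIntegral_iff_ofReal (ae_of_all _ fun s => tent_nonneg _ _), hrep x hx]
    exact ENNReal.ofReal_lt_top
  · rw [integral_eq_lintegral_of_nonneg_ae (ae_of_all _ fun s => tent_nonneg _ _) hm, hrep x hx,
      ENNReal.toReal_ofReal (h0 x hx)]

/-- Tonelli and the integrability of `f` make the tent kernel integrable on the product; a bounded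
factor `h` preserves this, and Fubini applies. The choice `h = 1` yields the mass. -/
theorem integral_tentObjective_representation [SFinite μ] (hT : AEMeasurable T μ)
    (h0 : ∀ x ∈ Ici a, 0 ≤ f x) (hi : IntegrableOn f (Ici a))
    (hrep : ∀ x ∈ Ici a, ∫⁻ s, ENNReal.ofReal (tent (T s) x) ∂μ = ENNReal.ofReal (f x))
    {h : ℝ → ℝ} (hm : Measurable h) (hb : ∃ M : ℝ, ∀ x, |h x| ≤ M) :
    Integrable (fun s => tentObjective a h (T s)) μ ∧
      ∫ s, tentObjective a h (T s) ∂μ = objective a h f := by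
  have hmK : AEMeasurable (fun z : ℝ × ℝ => tent (T z.2) z.1)
      ((volume.restrict (Ici a)).prod μ) :=
    ((hT.comp_quasiMeasurePreserving Measure.quasiMeasurePreserving_snd).sub
      measurable_fst.aemeasurable).max aemeasurable_const
  have hK : Integrable (fun z : ℝ × ℝ => tent (T z.2) z.1) ((volume.restrict (Ici a)).prod μ) := by
    refine ⟨hmK.aestronglyMeasurable, ?_⟩
    rw [hasFiniteIntegral_iff_ofReal (ae_of_all _ fun s => tent_nonneg _ _),
      lintegral_prod _ hmK.ennreal_ofReal]
    rw [setLIntegral_congr_fun measurableSet_Ici hrep]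
    exact hi.lintegral_lt_top
  obtain ⟨M, hM⟩ := hb
  have hKh : Integrable (fun z : ℝ × ℝ => h z.1 * tent (T z.2) z.1)
      ((volume.restrict (Ici a)).prod μ) :=
    hK.bdd_mul (hm.comp measurable_fst).aestronglyMeasurable
      (ae_of_all _ fun z => by simpa using hM z.1)
  refine ⟨hKh.integral_prod_right, ?_⟩
  simp only [tentObjective, objective]
  rw [← integral_integral_swap hKh]
  refine setIntegral_congr_fun measurableSet_Ici fun x hx => ?_
  rw [integral_const_mul, (integral_tent_representation hT h0 hrep hx).2]

end TentFubini

/-! ### Domination by three tents -/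

section ThreeAtoms

variable {a βl βu ηl ηu νu : ℝ} {f h : ℝ → ℝ}

/-- The value, the mass and the objective of a feasible function are matched by finitely many
weighted points. -/
theorem IsFeasible.exists_finset_weights (hνu : 0 < νu) (hm : Measurable h)
    (hb : ∃ M : ℝ, ∀ x, |h x| ≤ M) (H : IsFeasible a βl βu ηl ηu νu f) :
    ∃ (S : Finset ℝ) (w : ℝ → ℝ), (∀ t ∈ S, a ≤ t) ∧ (∀ t ∈ S, 0 ≤ w t) ∧ ∑ t ∈ S, w t = νu ∧
      ∑ t ∈ S, w t * (t - a) = f a ∧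
      ∑ t ∈ S, w t * ((t - a) ^ 2 / 2) = ∫ x in Ici a, f x ∧
      ∑ t ∈ S, w t * tentObjective a h t = objective a h f := by
  obtain ⟨T, hT, haT, hrep⟩ := H.exists_tent_representation hνu
  obtain ⟨hi0, he0⟩ := integral_tent_representation hT H.nonneg hrep self_mem_Ici
  obtain ⟨hi1, he1⟩ := integral_tentObjective_representation hT H.nonneg H.integrable hrep
    (h := fun _ => 1) measurable_const ⟨1, by simp⟩
  obtain ⟨hi2, he2⟩ := integral_tentObjective_representation hT H.nonneg H.integrable hrep hm hb
  let V : ℝ → ℝ × ℝ × ℝ := fun t => (tent t a, tentObjective a (fun _ => 1) t, tentObjective a h t)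
  let c : ENNReal := ENNReal.ofReal νu⁻¹
  have hprob : IsProbabilityMeasure (c • volume.restrict (Ioc 0 νu)) := by
    refine ⟨?_⟩
    simp only [c, Measure.smul_apply, Measure.restrict_apply_univ, Real.volume_Ioc, smul_eq_mul,
      sub_zero]
    rw [← ENNReal.ofReal_mul (by positivity), inv_mul_cancel₀ hνu.ne', ENNReal.ofReal_one]
  have hV : Integrable (fun s => V (T s)) (volume.restrict (Ioc 0 νu)) :=
    hi0.prodMk (hi1.prodMk hi2)
  -- Normalised Lebesgue measure on `(0, νu]` serves as the probability space. The curve `V` is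
  -- unbounded, so it matters that its hull need not be closed.
  have hmem := (convex_convexHull ℝ (V '' Ici a)).integral_mem_of_finiteDimensional
    (μ := c • volume.restrict (Ioc 0 νu)) (f := fun s => V (T s))
    (Measure.ae_smul_measure ((ae_restrict_mem measurableSet_Ioc).mono fun s hs =>
      subset_convexHull ℝ _ (mem_image_of_mem V (haT s hs))) c)
    (hV.smul_measure ENNReal.ofReal_ne_top)
  have hint : ∫ s, V (T s) ∂(c • volume.restrict (Ioc 0 νu)) =
      νu⁻¹ • (f a, ∫ x in Ici a, f x, objective a h f) := by
    rw [integral_smul_measure, ENNReal.toReal_ofReal (by positivity)]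
    simp only [V]
    rw [integral_pair hi0 (hi1.prodMk hi2), integral_pair hi1 hi2, he0, he1, he2]
    simp [objective]
  rw [hint, mem_convexHull_iff_exists_fintype] at hmem
  obtain ⟨ι, _, b, z, hb0, hb1, hz, hbz⟩ := hmem
  choose t ht htz using hz
  classical
  -- The points `t i` may coincide, so weights are collected over the fibres of `t`.
  have hsum : ∀ ψ : ℝ → ℝ, ∑ x ∈ Finset.univ.image t, (νu * ∑ i with t i = x, b i) * ψ x =
      νu * ∑ i, b i * ψ (t i) := by
    intro ψ
    rw [← Finset.sum_fiberwise_of_maps_to (s := Finset.univ) (t := Finset.univ.image t) (g := t)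
      (fun i _ => Finset.mem_image_of_mem t (Finset.mem_univ i)) (fun i => b i * ψ (t i)),
      Finset.mul_sum]
    refine Finset.sum_congr rfl fun x _ => ?_
    rw [mul_assoc, Finset.sum_mul]
    congr 1
    refine Finset.sum_congr rfl fun i hi => ?_
    rw [(Finset.mem_filter.1 hi).2]
  have hV' : νu • ∑ i, b i • V (t i) = (f a, ∫ x in Ici a, f x, objective a h f) := by
    simp only [htz, hbz]
    rw [smul_smul, mul_inv_cancel₀ hνu.ne', one_smul]
  have h1 := congrArg Prod.fst hV'
  have h2 := congrArg (fun v => v.2.1) hV'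
  have h3 := congrArg (fun v => v.2.2) hV'
  simp only [Prod.smul_fst, Prod.smul_snd, Prod.fst_sum, Prod.snd_sum, smul_eq_mul, V] at h1 h2 h3
  have ht1 : ∀ t, a ≤ t → tentObjective a (fun _ => 1) t = (t - a) ^ 2 / 2 := fun t ht => by
    simp [tentObjective, integral_tent ht]
  refine ⟨Finset.univ.image t, fun x => νu * ∑ i with t i = x, b i, ?_, ?_, ?_, ?_, ?_, ?_⟩
  · simpa using ht
  · exact fun x _ => mul_nonneg hνu.le (Finset.sum_nonneg fun i _ => hb0 i)
  · simpa [hb1] using hsum fun _ => 1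
  · rw [hsum fun x => x - a, ← h1]
    simp only [fun i => tent_of_le (ht i)]
  · rw [hsum fun x => (x - a) ^ 2 / 2, ← h2]
    simp only [fun i => ht1 _ (ht i)]
  · rw [hsum, ← h3]

/-- At most three positively weighted points can be listed in increasing order, if necessary with
weightless points in front. -/
theorem exists_fin_three_of_card_le_three {S : Finset ℝ} {w : ℝ → ℝ} (hS : S.card ≤ 3)
    (haS : ∀ t ∈ S, a ≤ t) (hw : ∀ t ∈ S, 0 < w t) (hne : 0 < ∑ t ∈ S, w t * (t - a)) :
    ∃ t v : Fin 3 → ℝ, a ≤ t 0 ∧ t 0 ≤ t 1 ∧ t 1 < t 2 ∧ (∀ i, 0 ≤ v i) ∧ 0 < v 2 ∧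
      ∀ ψ : ℝ → ℝ, ∑ i, v i * ψ (t i) = ∑ x ∈ S, w x * ψ x := by
  obtain ⟨n, hn, e, hmono, he, hsum⟩ : ∃ n ≤ 3, ∃ e : Fin n → ℝ, StrictMono e ∧ (∀ i, e i ∈ S) ∧
      ∀ ψ : ℝ → ℝ, ∑ x ∈ S, w x * ψ x = ∑ i, w (e i) * ψ (e i) := by
    refine ⟨S.card, hS, S.orderEmbOfFin rfl, (S.orderEmbOfFin rfl).strictMono,
      S.orderEmbOfFin_mem rfl, fun ψ => ?_⟩
    conv_lhs => rw [← Finset.map_orderEmbOfFin_univ S rfl]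
    rw [Finset.sum_map]
    rfl
  rw [hsum fun t => t - a] at hne
  simp only [hsum]
  have hpos := fun i => hw (e i) (he i)
  have hle := fun i => haS (e i) (he i)
  -- A positive value at `a` excludes having no atom, or a single one located at `a`. Missing atoms
  -- are padded at `a` with weight zero, so the last atom keeps its positive weight.
  interval_cases n
  · simp at hne
  · have hlt : a < e 0 := by
      refine lt_of_le_of_ne (hle 0) fun heq => ?_
      simp [← heq] at hne
    exact ⟨![a, a, e 0], ![0, 0, w (e 0)], le_rfl, le_rfl, hlt,
      by simp [Fin.forall_fin_succ, (hpos 0).le], hpos 0, by simp [Fin.sum_univ_three]⟩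
  · exact ⟨![a, e 0, e 1], ![0, w (e 0), w (e 1)], le_rfl, hle 0, hmono (by decide),
      by simp [Fin.forall_fin_succ, (hpos 0).le, (hpos 1).le], hpos 1,
      by simp [Fin.sum_univ_three]⟩
  · exact ⟨e, fun i => w (e i), hle 0, (hmono (by decide)).le, hmono (by decide),
      fun i => (hpos i).le, hpos 2, fun ψ => rfl⟩

/-- Every feasible function is dominated by a feasible superposition of three tents. -/
theorem IsFeasible.exists_three_tents (hνu : 0 < νu) (hηl : 0 < ηl) (hm : Measurable h)
    (hb : ∃ M : ℝ, ∀ x, |h x| ≤ M) (H : IsFeasible a βl βu ηl ηu νu f) :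
    ∃ t w : Fin 3 → ℝ, IsFeasibleAtoms a βl βu ηl ηu νu t w ∧ t 0 ≤ t 1 ∧ t 1 < t 2 ∧ 0 < w 2 ∧
      objective a h f ≤ objective a h (tents t w) := by
  obtain ⟨S, w, hS, hw, h0, h1, h2, h3⟩ := H.exists_finset_weights hνu hm hb
  obtain ⟨S', hS', w', hc, hw', e0, e1, e2, e3⟩ :=
    exists_card_le_three_weights (tentObjective a h) _ S w rfl hw
  have e1' : ∑ t ∈ S', w' t * (t - a) = f a := by
    rw [← h1]
    simp only [mul_sub, Finset.sum_sub_distrib, ← Finset.sum_mul, e0, e1]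
  have e2' : ∑ t ∈ S', w' t * ((t - a) ^ 2 / 2) = ∫ x in Ici a, f x := by
    rw [← h2]
    have key : ∀ (R : Finset ℝ) (v : ℝ → ℝ), ∑ t ∈ R, v t * ((t - a) ^ 2 / 2) =
        (∑ t ∈ R, v t * t ^ 2) / 2 - a * (∑ t ∈ R, v t * t) + a ^ 2 / 2 * ∑ t ∈ R, v t := by
      intro R v
      rw [Finset.sum_div, Finset.mul_sum, Finset.mul_sum, ← Finset.sum_sub_distrib,
        ← Finset.sum_add_distrib]
      exact Finset.sum_congr rfl fun t _ => by ring
    rw [key, key, e0, e1, e2]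
  obtain ⟨t, v, ht0, ht1, ht2, hv, hv2, hsum⟩ := exists_fin_three_of_card_le_three hc
    (fun t ht => hS t (hS' ht)) hw' (by rw [e1']; exact hηl.trans_le H.value_ge)
  refine ⟨t, v, ⟨?_, hv, ?_, ?_, ?_, ?_, ?_⟩, ht1, ht2, hv2, ?_⟩
  · intro i
    fin_cases i
    · exact ht0
    · exact ht0.trans ht1
    · exact ht0.trans (ht1.trans ht2.le)
  · have := hsum fun _ => 1
    simp only [mul_one] at this
    rw [this, e0, h0]
  · rw [hsum fun t => t - a, e1']; exact H.value_ge
  · rw [hsum fun t => t - a, e1']; exact H.value_le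
  · rw [hsum fun t => (t - a) ^ 2 / 2, e2']; exact H.mass_ge
  · rw [hsum fun t => (t - a) ^ 2 / 2, e2']; exact H.mass_le
  · rw [objective_tents a hm hb, hsum, ← h3]
    exact e3

end ThreeAtoms

/-! ### Compactness and escape of near-optimal supports -/

section Extremal

variable {a βl βu ηl ηu νu : ℝ} {h : ℝ → ℝ}

theorem bddAbove_objective (hb : ∃ M : ℝ, ∀ x, |h x| ≤ M) :
    BddAbove (objective a h '' {f | IsFeasible a βl βu ηl ηu νu f}) := by
  obtain ⟨M, hM⟩ := hb
  have hM0 : 0 ≤ M := (abs_nonneg _).trans (hM 0)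
  refine ⟨M * βu, ?_⟩
  rintro _ ⟨f, hf, rfl⟩
  have h1 : ∫ x in Ici a, h x * f x ≤ ∫ x in Ici a, M * f x := by
    -- Without integrability the objective takes the default value `0`, which obeys the same bound.
    by_cases hi : IntegrableOn (fun x => h x * f x) (Ici a)
    · exact setIntegral_mono_on hi (hf.integrable.const_mul M) measurableSet_Ici fun x hx =>
        mul_le_mul_of_nonneg_right ((le_abs_self _).trans (hM x)) (hf.nonneg x hx)
    · rw [integral_undef hi]
      exact setIntegral_nonneg measurableSet_Ici fun x hx => mul_nonneg hM0 (hf.nonneg x hx)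
  rw [integral_const_mul] at h1
  exact h1.trans (mul_le_mul_of_nonneg_left hf.mass_le hM0)

theorem isCompact_feasibleAtoms (R : ℝ) :
    IsCompact {q : (Fin 3 → ℝ) × (Fin 3 → ℝ) | IsFeasibleAtoms a βl βu ηl ηu νu q.1 q.2 ∧
      q.1 0 ≤ q.1 1 ∧ q.1 1 ≤ q.1 2 ∧ q.1 2 ≤ R} := by
  have hc : IsCompact ((univ.pi fun _ : Fin 3 => Icc a R) ×ˢ (univ.pi fun _ : Fin 3 => Icc 0 νu)) :=
    (isCompact_univ_pi fun _ => isCompact_Icc).prod (isCompact_univ_pi fun _ => isCompact_Icc)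
  refine hc.of_isClosed_subset ?_ ?_
  · have : {q : (Fin 3 → ℝ) × (Fin 3 → ℝ) | IsFeasibleAtoms a βl βu ηl ηu νu q.1 q.2 ∧
        q.1 0 ≤ q.1 1 ∧ q.1 1 ≤ q.1 2 ∧ q.1 2 ≤ R} =
        {q | (∀ i, a ≤ q.1 i) ∧ (∀ i, 0 ≤ q.2 i) ∧ ∑ i, q.2 i ≤ νu ∧
          ηl ≤ ∑ i, q.2 i * (q.1 i - a) ∧ ∑ i, q.2 i * (q.1 i - a) ≤ ηu ∧
          βl ≤ ∑ i, q.2 i * ((q.1 i - a) ^ 2 / 2) ∧ ∑ i, q.2 i * ((q.1 i - a) ^ 2 / 2) ≤ βu ∧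
          q.1 0 ≤ q.1 1 ∧ q.1 1 ≤ q.1 2 ∧ q.1 2 ≤ R} := by
      ext q
      constructor
      · rintro ⟨⟨h1, h2, h3, h4, h5, h6, h7⟩, h8⟩
        exact ⟨h1, h2, h3, h4, h5, h6, h7, h8⟩
      · rintro ⟨h1, h2, h3, h4, h5, h6, h7, h8⟩
        exact ⟨⟨h1, h2, h3, h4, h5, h6, h7⟩, h8⟩
    rw [this]
    simp only [ofPred_and, ofPred_forall]
    refine (isClosed_iInter fun i => isClosed_le (by fun_prop) (by fun_prop)).inter
      ((isClosed_iInter fun i => isClosed_le (by fun_prop) (by fun_prop)).inter ?_)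
    repeat' apply IsClosed.inter
    all_goals exact isClosed_le (by fun_prop) (by fun_prop)
  · rintro ⟨t, w⟩ ⟨H, h1, h2, h3⟩
    refine ⟨fun i _ => ⟨H.le_pos i, ?_⟩, fun i _ => ⟨H.weight_nonneg i, ?_⟩⟩
    · fin_cases i
      · exact h1.trans (h2.trans h3)
      · exact h2.trans h3
      · exact h3
    · exact (Finset.single_le_sum (fun j _ => H.weight_nonneg j) (Finset.mem_univ i)).trans
        H.weight_le

/-- If no optimal solution exists, then nearly optimal three-tent functions have arbitrarily long
supports. -/
theorem exists_far_tents (hνu : 0 < νu) (hηl : 0 < ηl) (hm : Measurable h)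
    (hb : ∃ M : ℝ, ∀ x, |h x| ≤ M) {Z : ℝ} (hZ : IsOptimalValue a βl βu ηl ηu νu h Z)
    (hno : ¬ ∃ f : ℝ → ℝ, IsOptimal a βl βu ηl ηu νu h f)
    (R : ℝ) {ε : ℝ} (hε : 0 < ε) :
    ∃ t w : Fin 3 → ℝ, IsFeasibleAtoms a βl βu ηl ηu νu t w ∧ t 0 ≤ t 1 ∧ t 1 < t 2 ∧ 0 < w 2 ∧
      R < t 2 ∧ Z - ε < objective a h (tents t w) := by
  have hlt : ∀ f, IsFeasible a βl βu ηl ηu νu f → objective a h f < Z := by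
    intro f hf
    refine lt_of_le_of_ne (hZ.1 ⟨f, hf, rfl⟩) fun heq => hno ⟨f, hf, fun g hg => ?_⟩
    rw [heq]
    exact hZ.1 ⟨g, hg, rfl⟩
  have happrox : ∀ b < Z, ∃ t w : Fin 3 → ℝ, IsFeasibleAtoms a βl βu ηl ηu νu t w ∧ t 0 ≤ t 1 ∧
      t 1 < t 2 ∧ 0 < w 2 ∧ b < objective a h (tents t w) := by
    intro b hbZ
    obtain ⟨_, ⟨f, hf, rfl⟩, hbf, -⟩ := hZ.exists_between hbZ
    obtain ⟨t, w, h1, h2, h3, h4, h5⟩ := hf.exists_three_tents hνu hηl hm hb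
    exact ⟨t, w, h1, h2, h3, h4, hbf.trans_le h5⟩
  set K := {q : (Fin 3 → ℝ) × (Fin 3 → ℝ) | IsFeasibleAtoms a βl βu ηl ηu νu q.1 q.2 ∧
      q.1 0 ≤ q.1 1 ∧ q.1 1 ≤ q.1 2 ∧ q.1 2 ≤ R} with hK
  -- On the compact set `K` the maximum is attained by a feasible function, which is not optimal, so
  -- it stays strictly below `Z`.
  obtain ⟨b, hbZ, hbK⟩ : ∃ b < Z, ∀ q ∈ K, objective a h (tents q.1 q.2) ≤ b := by
    rcases K.eq_empty_or_nonempty with hemp | hne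
    · exact ⟨Z - 1, by linarith, by simp [hemp]⟩
    · have hcont : ContinuousOn (fun q : (Fin 3 → ℝ) × (Fin 3 → ℝ) =>
          objective a h (tents q.1 q.2)) K := by
        simp only [objective_tents a hm hb]
        refine continuousOn_finsetSum _ fun i _ => ContinuousOn.mul (by fun_prop) ?_
        exact (continuousOn_tentObjective a hm hb).comp (by fun_prop) fun q hq => hq.1.le_pos i
      obtain ⟨q, hq, hmax⟩ := (isCompact_feasibleAtoms R).exists_isMaxOn hne hcont
      exact ⟨_, hlt _ hq.1.isFeasible, fun q' hq' => hmax hq'⟩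
  obtain ⟨t, w, h1, h2, h3, h4, h5⟩ := happrox (max b (Z - ε)) (max_lt hbZ (by linarith))
  refine ⟨t, w, h1, h2, h3, h4, ?_, (le_max_right _ _).trans_lt h5⟩
  by_contra! hle
  exact ((le_max_left _ _).trans_lt h5).not_ge (hbK (t, w) ⟨h1, h2, h3.le, hle⟩)

end Extremal

/-! ### The dichotomy -/

theorem theorem5 (a βl βu ηl ηu νu : ℝ)
    (hβl : 0 < βl) (hβu : 0 < βu) (hηl : 0 < ηl) (hηu : 0 < ηu) (hνu : 0 < νu)
    (h : ℝ → ℝ) (h_meas : Measurable h) (h_bdd : ∃ M : ℝ, ∀ x, |h x| ≤ M)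
    (h_feas : ∃ f : ℝ → ℝ, IsFeasible a βl βu ηl ηu νu f) :
    (∃ f ∈ PLPlus 3 a, IsOptimal a βl βu ηl ηu νu h f) ∨
    ((¬ ∃ f : ℝ → ℝ, IsOptimal a βl βu ηl ηu νu h f) ∧
      ∃ (Z : ℝ) (f : ℕ → ℝ → ℝ) (y : ℕ → Fin 4 → ℝ) (c d : ℕ → Fin 3 → ℝ),
        IsOptimalValue a βl βu ηl ηu νu h Z ∧
        (∀ k, f k ∈ PLPlus 3 a) ∧
        (∀ k, IsFeasible a βl βu ηl ηu νu (f k)) ∧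
        Tendsto (fun k => objective a h (f k)) atTop (𝓝 Z) ∧
        (∀ k, HasSegments a 3 (f k) (y k) (c k) (d k)) ∧
        -- the last segment is a genuine one: it has positive length and is not part of the zero tail
        (∀ k, y k 2 < y k 3 ∧ d k 2 < 0) ∧
        -- its right endpoint increases to infinity
        StrictMono (fun k => y k 3) ∧
        Tendsto (fun k => y k 3) atTop atTop ∧
        -- its steepness decreases to zero
        StrictAnti (fun k => |d k 2|) ∧
        Tendsto (fun k => d k 2) atTop (𝓝 0)) := by
  by_cases hex : ∃ f : ℝ → ℝ, IsOptimal a βl βu ηl ηu νu h f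
  · left
    obtain ⟨f, hf, hmax⟩ := hex
    obtain ⟨t, w, h1, h2, h3, h4, h5⟩ := hf.exists_three_tents hνu hηl h_meas h_bdd
    exact ⟨tents t w, tents_mem_PLPlus (h1.le_pos 0) h2 h3.le h1.weight_nonneg, h1.isFeasible,
      fun g hg => (hmax g hg).trans h5⟩
  right
  refine ⟨hex, ?_⟩
  have hne : {f | IsFeasible a βl βu ηl ηu νu f}.Nonempty := h_feas
  obtain ⟨Z, hZ⟩ : ∃ Z, IsOptimalValue a βl βu ηl ηu νu h Z :=
    ⟨_, isLUB_csSup (hne.image _) (bddAbove_objective h_bdd)⟩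
  choose t w hat ht01 ht12 hw2 htk hobj using fun k : ℕ =>
    exists_far_tents hνu hηl h_meas h_bdd hZ hex (k : ℝ) (ε := 1 / ((k : ℝ) + 1))
      (by positivity)
  have ht_top : Tendsto (fun k => t k 2) atTop atTop :=
    tendsto_atTop_mono (fun k => (htk k).le) tendsto_natCast_atTop_atTop
  -- The single term `w₂ (t₂ - a)` of the value at `a` is at most `ηu`, while `t₂ → ∞`.
  have hw_zero : Tendsto (fun k => w k 2) atTop (𝓝 0) := by
    have hlim : Tendsto (fun k => ηu / (t k 2 - a)) atTop (𝓝 0) :=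
      tendsto_const_nhds.div_atTop (tendsto_atTop_add_const_right _ (-a) ht_top)
    refine squeeze_zero (fun k => (hw2 k).le) (fun k => ?_) hlim
    have hpos : 0 < t k 2 - a := by
      have := (hat k).le_pos 0
      linarith [ht01 k, ht12 k]
    rw [le_div_iff₀ hpos]
    exact (Finset.single_le_sum (f := fun i => w k i * (t k i - a)) (fun j _ =>
      mul_nonneg ((hat k).weight_nonneg j) (sub_nonneg.2 ((hat k).le_pos j)))
      (Finset.mem_univ 2)).trans (hat k).value_le
  have hobj_lim : Tendsto (fun k => objective a h (tents (t k) (w k))) atTop (𝓝 Z) := by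
    have hlim : Tendsto (fun k : ℕ => Z - 1 / ((k : ℝ) + 1)) atTop (𝓝 (Z - 0)) :=
      tendsto_one_div_add_atTop_nhds_zero_nat.const_sub Z
    rw [sub_zero] at hlim
    exact tendsto_of_tendsto_of_tendsto_of_le_of_le hlim tendsto_const_nhds
      (fun k => (hobj k).le) fun k => hZ.1 ⟨_, (hat k).isFeasible, rfl⟩
  -- The first extraction makes the endpoints strictly increasing; the second, applied to the
  -- inverse weights, makes the slopes strictly decreasing in size and preserves the first property.
  obtain ⟨φ, hφ, hφt⟩ := strictMono_subseq_of_tendsto_atTop ht_top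
  have hinv : Tendsto (fun k => (w (φ k) 2)⁻¹) atTop atTop :=
    tendsto_inv_nhdsGT_zero.comp (tendsto_nhdsWithin_iff.2
      ⟨hw_zero.comp hφ.tendsto_atTop, Eventually.of_forall fun k => hw2 _⟩)
  obtain ⟨χ, hχ, hχw⟩ := strictMono_subseq_of_tendsto_atTop hinv
  have hψ : Tendsto (fun k => φ (χ k)) atTop atTop := (hφ.comp hχ).tendsto_atTop
  refine ⟨Z, fun k => tents (t (φ (χ k))) (w (φ (χ k))), _, _, _, hZ, fun k => ?_, fun k => ?_, ?_,
    fun k => hasSegments_tents ((hat _).le_pos 0) (ht01 _) (ht12 _).le, fun k => ⟨?_, ?_⟩,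
    ?_, ?_, ?_, ?_⟩
  · exact tents_mem_PLPlus ((hat _).le_pos 0) (ht01 _) (ht12 _).le (hat _).weight_nonneg
  · exact (hat _).isFeasible
  · exact hobj_lim.comp hψ
  · exact ht12 _
  · exact neg_lt_zero.2 (hw2 _)
  · exact hφt.comp hχ
  · exact ht_top.comp hψ
  · intro i j hij
    have h1 : (w (φ (χ i)) 2)⁻¹ < (w (φ (χ j)) 2)⁻¹ := hχw hij
    have h2 := (inv_lt_inv₀ (hw2 _) (hw2 _)).1 h1
    change |-(w (φ (χ j)) 2)| < |-(w (φ (χ i)) 2)|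
    rwa [abs_neg, abs_neg, abs_of_pos (hw2 _), abs_of_pos (hw2 _)]
  · have := (hw_zero.comp hψ).neg
    rw [neg_zero] at this
    exact this
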